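/- All graphs are finite and simple. For an indexed family $(S_v)_{v\in V}$ of nonempty sets (repetitions allowed), its intersection graph has vertex set $V$, and distinct $u,v$ are adjacent iff $S_u\cap S_v\neq\emptyset$; for a family of subgraphs, take $S_v$ to be the vertex sets. In a connected graph $M$ with distance $d$, let $I(u,v)=\{x : d(u,v)=d(u,x)+d(x,v)\}$; a subgraph of $M$ is convex if its vertex set $S$ satisfies $I(u,v)\subseteq S$ for all $u,v\in S$. A median graph is a connected graph in which $I(u,v)\cap I(u,w)\cap I(v,w)$ is a single vertex for every three distinct vertices $u,v,w$. The path-dimension of a graph is the minimum $k\ge 0$ such that it has a distance-preserving map into the Cartesian product of $k$ (finite, nonempty) paths, and is infinite if there is no such $k$. (A product of $0$ paths is a single vertex.) Let $G$ be a graph. - The boxicity $\mathrm{box}(G)$ is the minimum $k\ge 0$ such that $G$ is isomorphic to the intersection graph of a family of axis-aligned boxes in $\mathbb{R}^k$. - A path-decomposition of $G$ is a pair $(P,\beta)$ with $P$ a path and $\beta:V(P)\to 2^{V(G)}$, such that for every $v\in V(G)$ the set $\beta^{-1}(v)=\{t : v\in\beta(t)\}$ is nonempty and induces a connected subgraph of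 $P$, and such that the intersection graph $H$ of $(\beta^{-1}(v))_{v\in V(G)}$ is an interval graph containing $G$ as a spanning subgraph. It separates a non-edge $uv$ of $G$ if $uv$ is also a non-edge of $H$. A family of path-decompositions of $G$ is non-edge-separating if every non-edge of $G$ is separated by some member of the family. - A complete $k$-path-median-decomposition of $G$ is a pair $(M,\gamma)$ with $M$ a median graph of path-dimension $k$ and $\gamma:V(M)\to 2^{V(G)}$, such that for every $v\in V(G)$ the set $\gamma^{-1}(v)=\{x : v\in\gamma(x)\}$ is nonempty and convex in $M$, such that the intersection graph of $(\gamma^{-1}(v))_{v\in V(G)}$ contains $G$ as a spanning subgraph, and such that every bag $\gamma(x)$ is a clique of $G$. The path-median-dimension of $G$ is the minimum $k\ge 0$ such that $G$ has a complete $k$-path-median-decomposition. Theorem. Let $G$ be a graph and let $k$ be a positive integer. Then the following are equivalent: 1. $\mathrm{box}(G)=k$. 2. The minimum size of a non-edge-separating family of path-decompositions of $G$ is $k$. 3. $k$ is the minimum integer $m\ge 0$ such that $G$ is the intersection graph of a family of convex subgraphs of the Cartesian product of $m$ paths. 4. $k$ is the minimum integer $m\ge 0$ such that $G$ is the intersection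 graph of a family of convex subgraphs of a median graph of path-dimension $m$. 5. The path-median-dimension of $G$ is $k$. -/

import Mathlib

namespace SimpleGraph

/-- `G` is (up to relabelling its vertices by the index set) the intersection graph of the family
`S` of nonempty sets: distinct indices are adjacent iff their sets meet. The family is indexed, so
sets may be repeated. -/
def IsIntersectionGraph {V X : Type*} (G : SimpleGraph V) (S : V → Set X) : Prop :=
  (∀ v, (S v).Nonempty) ∧ ∀ u v, u ≠ v → (G.Adj u v ↔ (S u ∩ S v).Nonempty)

/-- Intersection graphs of axis-aligned (closed) boxes in `ℝ^k`; the box with corners `a ≤ b` is the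
product `Set.Icc a b` of the intervals `[a i, b i]`. -/
def HasBoxRepresentation {V : Type*} (G : SimpleGraph V) (k : ℕ) : Prop :=
  ∃ a b : V → (Fin k → ℝ), (∀ v, a v ≤ b v) ∧
    G.IsIntersectionGraph (fun v => Set.Icc (a v) (b v))

/-- The boxicity: the minimum `k` such that `G` is the intersection graph of a family of boxes in
`ℝ^k` (`⊤` if there is none). -/
noncomputable def boxicity {V : Type*} (G : SimpleGraph V) : ℕ∞ :=
  ⨅ (k : ℕ) (_ : G.HasBoxRepresentation k), (k : ℕ∞)

/-- Interval graphs: intersection graphs of intervals of the real line. -/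
def IsIntervalGraph {V : Type*} (G : SimpleGraph V) : Prop :=
  ∃ S : V → Set ℝ, (∀ v, (S v).OrdConnected) ∧ G.IsIntersectionGraph S

/-- A path-decomposition of `G`: a representation of an interval completion `H` of `G` over a path
with vertices `0, …, n`. The preimage of `v` under `bag` is `{t | v ∈ bag t}`. -/
structure PathDecomposition {V : Type*} (G : SimpleGraph V) where
  /-- The number of edges of the underlying path. -/
  n : ℕ
  /-- The bags. -/
  bag : Fin (n + 1) → Set V
  /-- The interval completion that is represented. -/
  completion : SimpleGraph V
  le_completion : G ≤ completion
  isIntervalGraph : completion.IsIntervalGraph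
  connected : ∀ v, ((pathGraph (n + 1)).induce {t | v ∈ bag t}).Connected
  isIntersectionGraph : completion.IsIntersectionGraph (fun v => {t | v ∈ bag t})

/-- A path-decomposition separates the pair `u, v` if `u, v` is a non-edge of its completion. -/
def PathDecomposition.Separates {V : Type*} {G : SimpleGraph V} (D : G.PathDecomposition)
    (u v : V) : Prop :=
  ¬ D.completion.Adj u v

/-- Every non-edge of `G` is separated by a member of the family. -/
def IsNonEdgeSeparating {V : Type*} {G : SimpleGraph V} (F : Finset G.PathDecomposition) : Prop :=
  ∀ u v, u ≠ v → ¬ G.Adj u v → ∃ D ∈ F, D.Separates u v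

/-- The Cartesian product of a family of graphs. -/
def cartesianProduct {ι : Type*} {X : ι → Type*} (G : ∀ i, SimpleGraph (X i)) :
    SimpleGraph (∀ i, X i) where
  Adj x y := ∃ i, (G i).Adj (x i) (y i) ∧ ∀ j, j ≠ i → x j = y j
  symm := ⟨fun _ _ ⟨i, h, e⟩ => ⟨i, h.symm, fun j hj => (e j hj).symm⟩⟩
  loopless := ⟨fun _ ⟨_, h, _⟩ => h.ne rfl⟩

/-- The Cartesian product of `k` paths, the `i`-th of which has vertices `0, …, n i`. -/
def pathProduct {k : ℕ} (n : Fin k → ℕ) : SimpleGraph (∀ i, Fin (n i + 1)) :=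
  cartesianProduct fun i => pathGraph (n i + 1)

/-- The set `I(u, v)` of vertices on shortest `(u, v)`-paths, for a connected graph. -/
def geodesicInterval {X : Type*} (M : SimpleGraph X) (u v : X) : Set X :=
  {x | M.dist u v = M.dist u x + M.dist x v}

/-- Geodesically convex vertex sets (of a connected graph). -/
def IsGeodesicallyConvex {X : Type*} (M : SimpleGraph X) (S : Set X) : Prop :=
  ∀ u ∈ S, ∀ v ∈ S, M.geodesicInterval u v ⊆ S

/-- Median graphs. -/
def IsMedianGraph {X : Type*} (M : SimpleGraph X) : Prop :=
  M.Connected ∧ ∀ u v w, u ≠ v → u ≠ w → v ≠ w →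
    ∃ x, M.geodesicInterval u v ∩ M.geodesicInterval u w ∩ M.geodesicInterval v w = {x}

/-- Isometric embeddings of graphs. -/
def IsIsometricEmbedding {X Y : Type*} (M : SimpleGraph X) (N : SimpleGraph Y) (φ : X → Y) : Prop :=
  ∀ u v, M.edist u v = N.edist (φ u) (φ v)

/-- The path-dimension: the minimum `k` such that `M` embeds isometrically into the Cartesian product
of `k` paths, and `⊤` if there is none. -/
noncomputable def pathDimension {X : Type*} (M : SimpleGraph X) : ℕ∞ :=
  ⨅ (k : ℕ) (_ : ∃ (n : Fin k → ℕ) (φ : X → ∀ i, Fin (n i + 1)),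
    M.IsIsometricEmbedding (pathProduct n) φ), (k : ℕ∞)

/-- `G` is the intersection graph of a family of convex subgraphs of `M`. -/
def IsConvexIntersectionGraph {V X : Type*} (G : SimpleGraph V) (M : SimpleGraph X) : Prop :=
  ∃ S : V → M.Subgraph, (∀ v, M.IsGeodesicallyConvex (S v).verts) ∧
    G.IsIntersectionGraph (fun v => (S v).verts)

/-- `G` is the intersection graph of a family of convex subgraphs of a (finite) median graph of
path-dimension `k`. -/
def HasPathMedianRepresentation {V : Type*} (G : SimpleGraph V) (k : ℕ) : Prop :=
  ∃ (X : Type) (_ : Finite X) (M : SimpleGraph X),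
    M.IsMedianGraph ∧ M.pathDimension = k ∧ G.IsConvexIntersectionGraph M

/-- A `k`-path-median-decomposition of `G`: a representation `(M, bag)`, with `M` a (finite) median
graph of path-dimension `k`, of a completion `H` of `G`; here `H` is a supergraph of `G` on the same
vertices that is the intersection graph of convex subgraphs of a median graph of path-dimension `k`
(which the representation itself exhibits). -/
structure PathMedianDecomposition {V : Type*} (G : SimpleGraph V) (k : ℕ) where
  /-- The vertex set of the median graph. -/
  X : Type
  finite : Finite X
  /-- The median graph. -/
  M : SimpleGraph X
  isMedianGraph : M.IsMedianGraph
  pathDimension_eq : M.pathDimension = k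
  /-- The bags. -/
  bag : X → Set V
  /-- The completion that is represented. -/
  completion : SimpleGraph V
  le_completion : G ≤ completion
  convex : ∀ v, M.IsGeodesicallyConvex {x | v ∈ bag x}
  isIntersectionGraph : completion.IsIntersectionGraph (fun v => {x | v ∈ bag x})

/-- The decomposition is complete if every bag is a clique of `G`. -/
def PathMedianDecomposition.IsComplete {V : Type*} {G : SimpleGraph V} {k : ℕ}
    (D : G.PathMedianDecomposition k) : Prop :=
  ∀ x, G.IsClique (D.bag x)

/-- The path-median-dimension: the minimum `k` such that `G` has a complete
`k`-path-median-decomposition (`⊤` if there is none). -/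
noncomputable def pathMedianDimension {V : Type*} (G : SimpleGraph V) : ℕ∞ :=
  ⨅ (k : ℕ) (_ : ∃ D : G.PathMedianDecomposition k, D.IsComplete), (k : ℕ∞)

end SimpleGraph

/-! Each kind of representation using m coordinates yields a box representation in dimension at most
m, and conversely, so all the minima agree. Ranking endpoints moves boxes into a product of paths,
which is itself a median graph whose intervals `Set.Icc a b` are convex. The substantial direction
goes from a median graph M, isometrically embedded in a product of k paths, back to boxes: replace
each convex set by the bounding box of its image. Meeting sets clearly have meeting boxes. If two
convex sets are disjoint, a closest pair s, t consists of mutual gates, so any coordinate in which s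
and t differ separates the two sets, hence their boxes
(`IsMedianGraph.exists_coordinate_separating`). For path-decompositions, each coordinate of a box
representation gives an interval completion of G; a family is non-edge-separating exactly when G is
the intersection of its completions. -/

namespace SimpleGraph

/-! ### Comparing minima -/

section Minima

/-- Two sets of naturals that bound each other from below have the same least elements. -/
theorem isLeast_congr_of_forall_exists_le {S T : Set ℕ} (h₁ : ∀ m ∈ S, ∃ l ≤ m, l ∈ T)
    (h₂ : ∀ m ∈ T, ∃ l ≤ m, l ∈ S) (k : ℕ) : IsLeast S k ↔ IsLeast T k := by
  have key : ∀ {S T : Set ℕ}, (∀ m ∈ S, ∃ l ≤ m, l ∈ T) → (∀ m ∈ T, ∃ l ≤ m, l ∈ S) →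
      IsLeast S k → IsLeast T k := by
    rintro S T h₁ h₂ ⟨hk, hmin⟩
    have lower : ∀ m ∈ T, k ≤ m := fun m hm => by
      obtain ⟨l, hl, hlS⟩ := h₂ m hm
      exact (hmin hlS).trans hl
    obtain ⟨l, hl, hlT⟩ := h₁ k hk
    exact ⟨le_antisymm hl (lower l hlT) ▸ hlT, lower⟩
  exact ⟨key h₁ h₂, key h₂ h₁⟩

theorem iInf_natCast_eq_iff_isLeast (p : ℕ → Prop) (k : ℕ) :
    (⨅ (m : ℕ) (_ : p m), (m : ℕ∞)) = k ↔ IsLeast {m | p m} k := by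
  classical
  have of_isLeast : ∀ l, IsLeast {m | p m} l → (⨅ (m : ℕ) (_ : p m), (m : ℕ∞)) = l := by
    rintro l ⟨hl, hmin⟩
    refine le_antisymm (iInf₂_le l hl) (le_iInf₂ fun m hm => ?_)
    exact_mod_cast hmin hm
  refine ⟨fun h => ?_, of_isLeast k⟩
  by_cases hp : ∃ m, p m
  · have hl : IsLeast {m | p m} (Nat.find hp) :=
      ⟨Nat.find_spec hp, fun m hm => Nat.find_min' hp hm⟩
    have : ((Nat.find hp : ℕ) : ℕ∞) = k := (of_isLeast _ hl).symm.trans h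
    rwa [Nat.cast_inj.mp this] at hl
  · have : (⨅ (m : ℕ) (_ : p m), (m : ℕ∞)) = ⊤ := by
      simp only [iInf_eq_top]
      exact fun m hm => (hp ⟨m, hm⟩).elim
    rw [this] at h
    exact (ENat.top_ne_natCast k h).elim

end Minima

/-! ### Intervals in linear orders and subpaths -/

section Intervals

theorem Icc_inter_Icc_nonempty_iff {α : Type*} [Lattice α] {a b c d : α} (hab : a ≤ b)
    (hcd : c ≤ d) : (Set.Icc a b ∩ Set.Icc c d).Nonempty ↔ a ≤ d ∧ c ≤ b := by
  rw [Set.Icc_inter_Icc, Set.nonempty_Icc, sup_le_iff, le_inf_iff, le_inf_iff]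
  tauto

theorem exists_eq_Icc_of_ordConnected {α : Type*} [LinearOrder α] [Finite α] {S : Set α}
    (hne : S.Nonempty) (hS : S.OrdConnected) : ∃ a b, a ≤ b ∧ S = Set.Icc a b := by
  obtain ⟨a, ha⟩ := S.toFinite.exists_minimal hne
  obtain ⟨b, hb⟩ := S.toFinite.exists_maximal hne
  have hmin : ∀ x ∈ S, a ≤ x := fun x hx => (le_total a x).elim id fun h => ha.2 hx h
  have hmax : ∀ x ∈ S, x ≤ b := fun x hx => (le_total x b).elim id fun h => hb.2 hx h
  exact ⟨a, b, hmin b hb.1,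
    Set.Subset.antisymm (fun x hx => ⟨hmin x hx, hmax x hx⟩) (hS.out ha.1 hb.1)⟩

/-- A finite family of intervals of a linear order can be moved to a finite path. -/
theorem exists_fin_endpoints {V α : Type*} [Finite V] [LinearOrder α] (a b : V → α) :
    ∃ (n : ℕ) (a' b' : V → Fin (n + 1)), ∀ u v, a' u ≤ b' v ↔ a u ≤ b v := by
  classical
  cases nonempty_fintype V
  let P : Finset α := Finset.univ.image b
  -- The rank counts right endpoints strictly below x; if b v < a u, then b v itself is counted for
  -- a u but not for b v.
  let r : α → Fin (P.card + 1) := fun x =>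
    ⟨(P.filter (· < x)).card, Nat.lt_succ_of_le (Finset.card_filter_le _ _)⟩
  refine ⟨P.card, fun v => r (a v), fun v => r (b v), fun u v => ?_⟩
  change (P.filter (· < a u)).card ≤ (P.filter (· < b v)).card ↔ a u ≤ b v
  constructor
  · contrapose!
    intro h
    refine Finset.card_lt_card (Finset.ssubset_iff_of_subset ?_ |>.mpr ⟨b v, ?_, ?_⟩)
    · intro x hx
      simp only [Finset.mem_filter] at hx ⊢
      exact ⟨hx.1, hx.2.trans h⟩
    · simp [P, h]
    · simp
  · intro h
    refine Finset.card_le_card fun x hx => ?_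
    simp only [Finset.mem_filter] at hx ⊢
    exact ⟨hx.1, hx.2.trans_le h⟩

theorem connected_induce_pathGraph_Icc {n : ℕ} {a b : Fin n} (hab : a ≤ b) :
    ((pathGraph n).induce (Set.Icc a b)).Connected := by
  have reach : ∀ (d : ℕ) (x : Fin n) (hx : x ∈ Set.Icc a b), (x : ℕ) = a + d →
      ((pathGraph n).induce (Set.Icc a b)).Reachable ⟨a, le_rfl, hab⟩ ⟨x, hx⟩ := by
    intro d
    induction d with
    | zero =>
      intro x hx h
      obtain rfl : a = x := Fin.ext (by omega)
      exact Reachable.refl _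
    | succ d ih =>
      intro x hx h
      have hxn := x.isLt
      have hxb : (x : ℕ) ≤ b := hx.2
      let y : Fin n := ⟨a + d, by omega⟩
      have hy : y ∈ Set.Icc a b :=
        ⟨Fin.le_def.mpr (by simp [y]), Fin.le_def.mpr (by simp only [y]; omega)⟩
      refine (ih y hy rfl).trans (Adj.reachable ?_)
      rw [comap_adj, pathGraph_adj]
      left
      simp only [Function.Embedding.subtype_apply, y]
      omega
  have : Nonempty (Set.Icc a b) := ⟨⟨a, le_rfl, hab⟩⟩
  have root : ∀ x : Set.Icc a b,
      ((pathGraph n).induce (Set.Icc a b)).Reachable ⟨a, le_rfl, hab⟩ x := fun ⟨x, hx⟩ =>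
    reach (x - a) x hx (by have : (a : ℕ) ≤ x := hx.1; omega)
  exact Connected.mk fun x y => (root x).symm.trans (root y)

/-- Steps in a path change the position by one, so a walk avoiding y cannot get from below y to
above it. -/
theorem ordConnected_of_connected_induce_pathGraph {n : ℕ} {S : Set (Fin n)}
    (h : ((pathGraph n).induce S).Connected) : S.OrdConnected := by
  refine ⟨fun x hx z hz y hy => ?_⟩
  by_contra hyS
  have below : ∀ {u v : S}, ((pathGraph n).induce S).Walk u v → (u : Fin n) < y →
      (v : Fin n) < y := by
    intro u v p
    induction p with
    | nil => exact id
    | @cons u v w huv _ ih =>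
      intro hu
      apply ih
      rw [comap_adj, pathGraph_adj] at huv
      have hvy : (v : Fin n) ≠ y := fun e => hyS (e ▸ v.2)
      have hvy' : ((v : Fin n) : ℕ) ≠ y := fun e => hvy (Fin.ext e)
      simp only [Function.Embedding.subtype_apply] at huv
      rw [Fin.lt_def] at hu ⊢
      omega
  obtain ⟨p⟩ := h.preconnected ⟨x, hx⟩ ⟨z, hz⟩
  have hxy : x < y := lt_of_le_of_ne hy.1 fun e => hyS (e ▸ hx)
  exact (below p hxy).not_ge hy.2

end Intervals

/-! ### Metric and convexity in products of paths -/

section PathProduct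

variable {k : ℕ} {n : Fin k → ℕ}

/-- The `ℓ¹`-distance on a product of paths. -/
def gridDist (x y : ∀ i, Fin (n i + 1)) : ℕ :=
  ∑ i, (((x i : ℕ) - y i) + ((y i : ℕ) - x i))

theorem eq_of_gridDist_eq_zero {x y : ∀ i, Fin (n i + 1)} (h : gridDist x y = 0) : x = y := by
  rw [gridDist, Finset.sum_eq_zero_iff] at h
  funext i
  have := h i (Finset.mem_univ i)
  exact Fin.ext (by omega)

/-- Only coordinate i can alter the sum. The slacks c and d express a change of one in either
direction without subtraction. -/
theorem gridDist_of_agree {x z y : ∀ i, Fin (n i + 1)} {i : Fin k} {c d : ℕ}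
    (hi : ((x i : ℕ) - y i) + ((y i : ℕ) - x i) + c ≤ ((z i : ℕ) - y i) + ((y i : ℕ) - z i) + d)
    (hj : ∀ j, j ≠ i → x j = z j) : gridDist x y + c ≤ gridDist z y + d := by
  rw [gridDist, gridDist, ← Finset.add_sum_erase _ _ (Finset.mem_univ i),
    ← Finset.add_sum_erase _ _ (Finset.mem_univ i)]
  have : ∑ j ∈ Finset.univ.erase i, (((x j : ℕ) - y j) + ((y j : ℕ) - x j)) =
      ∑ j ∈ Finset.univ.erase i, (((z j : ℕ) - y j) + ((y j : ℕ) - z j)) :=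
    Finset.sum_congr rfl fun j hjmem => by rw [hj j (Finset.ne_of_mem_erase hjmem)]
  omega

theorem gridDist_le_length {x y : ∀ i, Fin (n i + 1)} (p : (pathProduct n).Walk x y) :
    gridDist x y ≤ p.length := by
  induction p with
  | nil => simp [gridDist]
  | @cons x z y hxz p ih =>
    obtain ⟨i, hi, hj⟩ := id hxz
    rw [pathGraph_adj] at hi
    have := gridDist_of_agree (x := x) (z := z) (y := y) (i := i) (c := 0) (d := 1)
      (by omega) hj
    rw [Walk.length_cons]
    omega

theorem exists_walk_length_eq_gridDist (x y : ∀ i, Fin (n i + 1)) :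
    ∃ p : (pathProduct n).Walk x y, p.length = gridDist x y := by
  induction h : gridDist x y generalizing x with
  | zero =>
    obtain rfl := eq_of_gridDist_eq_zero h
    exact ⟨Walk.nil, rfl⟩
  | succ d ih =>
    obtain ⟨i, hi⟩ : ∃ i, x i ≠ y i := by
      by_contra! hall
      obtain rfl : x = y := funext hall
      simp [gridDist] at h
    obtain ⟨c, hadj, hc⟩ : ∃ c : Fin (n i + 1), (pathGraph (n i + 1)).Adj (x i) c ∧
        ((x i : ℕ) - y i) + ((y i : ℕ) - x i) = ((c : ℕ) - y i) + ((y i : ℕ) - c) + 1 := by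
      have hx := (x i).isLt
      have hy := (y i).isLt
      rcases lt_or_gt_of_ne hi with hlt | hlt <;> rw [Fin.lt_def] at hlt
      · refine ⟨⟨x i + 1, by omega⟩, ?_, ?_⟩
        · rw [pathGraph_adj]; exact Or.inl rfl
        · simp only; omega
      · refine ⟨⟨x i - 1, by omega⟩, ?_, ?_⟩
        · rw [pathGraph_adj]; right; simp only; omega
        · simp only; omega
    let z := Function.update x i c
    have hzi : z i = c := Function.update_self ..
    have hzj : ∀ j, j ≠ i → x j = z j := fun j hj => (Function.update_of_ne hj _ _).symm
    have h₁ := gridDist_of_agree (x := x) (z := z) (y := y) (i := i) (c := 0) (d := 1)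
      (by rw [hzi]; omega) hzj
    have h₂ := gridDist_of_agree (x := z) (z := x) (y := y) (i := i) (c := 1) (d := 0)
      (by rw [hzi]; omega) fun j hj => (hzj j hj).symm
    obtain ⟨p, hp⟩ := ih z (by omega)
    have hxz : (pathProduct n).Adj x z := ⟨i, hzi.symm ▸ hadj, hzj⟩
    exact ⟨Walk.cons hxz p, by rw [Walk.length_cons, hp]⟩

theorem connected_pathProduct (n : Fin k → ℕ) : (pathProduct n).Connected :=
  Connected.mk fun x y => ⟨(exists_walk_length_eq_gridDist x y).choose⟩

theorem dist_pathProduct (x y : ∀ i, Fin (n i + 1)) :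
    (pathProduct n).dist x y = gridDist x y := by
  obtain ⟨p, hp⟩ := exists_walk_length_eq_gridDist x y
  obtain ⟨q, hq⟩ := (connected_pathProduct n).exists_walk_length_eq_dist x y
  exact le_antisymm (hp ▸ dist_le p) (hq ▸ gridDist_le_length q)

/-- The triangle inequality holds in every coordinate, so equality of the sums forces equality in
each. -/
theorem gridDist_eq_add_iff (x y z : ∀ i, Fin (n i + 1)) :
    gridDist x z = gridDist x y + gridDist y z ↔
      ∀ i, (x i ≤ y i ∧ y i ≤ z i) ∨ (z i ≤ y i ∧ y i ≤ x i) := by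
  rw [gridDist, gridDist, gridDist, ← Finset.sum_add_distrib,
    Finset.sum_eq_sum_iff_of_le fun i _ => by omega]
  refine ⟨fun h i => ?_, fun h i _ => ?_⟩
  · have := h i (Finset.mem_univ i)
    simp only [Fin.le_def]
    omega
  · have := h i
    simp only [Fin.le_def] at this
    omega

theorem mem_geodesicInterval_pathProduct {x y z : ∀ i, Fin (n i + 1)} :
    y ∈ (pathProduct n).geodesicInterval x z ↔
      ∀ i, (x i ≤ y i ∧ y i ≤ z i) ∨ (z i ≤ y i ∧ y i ≤ x i) := by
  rw [← gridDist_eq_add_iff, geodesicInterval, Set.mem_ofPred_eq, dist_pathProduct,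
    dist_pathProduct, dist_pathProduct]

theorem exists_median_of_linearOrder {α : Type*} [LinearOrder α] (u v w : α) :
    ∃ m, ∀ t, (((u ≤ t ∧ t ≤ v) ∨ (v ≤ t ∧ t ≤ u)) ∧ ((u ≤ t ∧ t ≤ w) ∨ (w ≤ t ∧ t ≤ u)) ∧
      ((v ≤ t ∧ t ≤ w) ∨ (w ≤ t ∧ t ≤ v))) ↔ t = m := by
  rcases le_total u v with h₁ | h₁ <;> rcases le_total u w with h₂ | h₂ <;>
    rcases le_total v w with h₃ | h₃
  · exact ⟨v, fun t => by grind⟩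
  · exact ⟨w, fun t => by grind⟩
  · exact ⟨u, fun t => by grind⟩
  · exact ⟨u, fun t => by grind⟩
  · exact ⟨u, fun t => by grind⟩
  · exact ⟨u, fun t => by grind⟩
  · exact ⟨w, fun t => by grind⟩
  · exact ⟨v, fun t => by grind⟩

theorem isMedianGraph_pathProduct (n : Fin k → ℕ) : (pathProduct n).IsMedianGraph := by
  refine ⟨connected_pathProduct n, fun u v w _ _ _ => ?_⟩
  choose m hm using fun i => exists_median_of_linearOrder (u i) (v i) (w i)
  refine ⟨m, Set.ext fun t => ?_⟩
  rw [Set.mem_inter_iff, Set.mem_inter_iff, mem_geodesicInterval_pathProduct,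
    mem_geodesicInterval_pathProduct, mem_geodesicInterval_pathProduct, Set.mem_singleton_iff,
    funext_iff, ← forall_and, ← forall_and]
  exact forall_congr' fun i => by rw [← hm i, and_assoc]

theorem isGeodesicallyConvex_Icc_pathProduct (a b : ∀ i, Fin (n i + 1)) :
    (pathProduct n).IsGeodesicallyConvex (Set.Icc a b) := by
  intro u hu v hv x hx
  rw [mem_geodesicInterval_pathProduct] at hx
  refine ⟨fun i => ?_, fun i => ?_⟩
  · rcases hx i with h | h
    · exact (hu.1 i).trans h.1
    · exact (hv.1 i).trans h.1
  · rcases hx i with h | h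
    · exact h.2.trans (hv.2 i)
    · exact h.2.trans (hu.2 i)

/-- The dimension may be below k, since factors may be single vertices. -/
theorem exists_pathDimension_pathProduct_eq (n : Fin k → ℕ) :
    ∃ m ≤ k, (pathProduct n).pathDimension = m := by
  have hle : (pathProduct n).pathDimension ≤ k := iInf₂_le k ⟨n, id, fun _ _ => rfl⟩
  obtain ⟨m, hm⟩ := ENat.ne_top_iff_exists.mp (ne_top_of_le_ne_top (ENat.natCast_ne_top k) hle)
  exact ⟨m, by rw [← hm] at hle; exact_mod_cast hle, hm.symm⟩

end PathProduct

/-! ### Gates and separation in median graphs -/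

section Median

variable {X : Type*} {M : SimpleGraph X}

theorem IsMedianGraph.exists_median (hM : M.IsMedianGraph) (u v w : X) :
    ∃ x, x ∈ M.geodesicInterval u v ∧ x ∈ M.geodesicInterval u w ∧
      x ∈ M.geodesicInterval v w := by
  by_cases huv : u = v
  · subst huv
    exact ⟨u, by simp [geodesicInterval]⟩
  by_cases huw : u = w
  · subst huw
    exact ⟨u, by simp [geodesicInterval]⟩
  by_cases hvw : v = w
  · subst hvw
    exact ⟨v, by simp [geodesicInterval]⟩
  obtain ⟨x, hx⟩ := hM.2 u v w huv huw hvw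
  have : x ∈ M.geodesicInterval u v ∩ M.geodesicInterval u w ∩ M.geodesicInterval v w :=
    hx ▸ rfl
  exact ⟨x, this.1.1, this.1.2, this.2⟩

/-- If `s` is a point of the convex set `S` that is closest to `t`, then it is a gate for `t`. -/
theorem IsMedianGraph.mem_geodesicInterval_of_closest (hM : M.IsMedianGraph) {S : Set X}
    (hS : M.IsGeodesicallyConvex S) {s t : X} (hs : s ∈ S)
    (hmin : ∀ x ∈ S, M.dist s t ≤ M.dist x t) {x : X} (hx : x ∈ S) :
    s ∈ M.geodesicInterval x t := by
  obtain ⟨m, h₁, h₂, h₃⟩ := hM.exists_median s x t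
  -- The median m lies in S and on a geodesic from s to t, so minimality forces m = s.
  have hmS : m ∈ S := hS s hs x hx h₁
  have h : M.dist s t = M.dist s m + M.dist m t := h₂
  have hle := hmin m hmS
  have : M.dist s m = 0 := by omega
  rw [hM.1.dist_eq_zero_iff] at this
  exact this ▸ h₃

/-- Disjoint convex sets of a median graph in a product of paths are separated by a coordinate. -/
theorem IsMedianGraph.exists_coordinate_separating (hM : M.IsMedianGraph) {k : ℕ}
    {n : Fin k → ℕ} {φ : X → ∀ i, Fin (n i + 1)}
    (hφ : M.IsIsometricEmbedding (pathProduct n) φ) {S T : Set X}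
    (hS : M.IsGeodesicallyConvex S) (hT : M.IsGeodesicallyConvex T) (hSne : S.Nonempty)
    (hTne : T.Nonempty) (hdisj : ¬ (S ∩ T).Nonempty) :
    ∃ i, (∀ x ∈ S, ∀ y ∈ T, φ x i < φ y i) ∨ (∀ x ∈ S, ∀ y ∈ T, φ y i < φ x i) := by
  have hdist : ∀ u v, M.dist u v = gridDist (φ u) (φ v) := fun u v => by
    rw [← dist_pathProduct, SimpleGraph.dist, SimpleGraph.dist, hφ u v]
  obtain ⟨⟨s, t⟩, ⟨hs, ht⟩, hmin⟩ := WellFounded.has_min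
    (measure fun p : X × X => M.dist p.1 p.2).wf (S ×ˢ T) (hSne.prod hTne)
  have hmin' : ∀ x ∈ S, ∀ y ∈ T, M.dist s t ≤ M.dist x y := fun x hx y hy =>
    not_lt.mp (hmin (x, y) ⟨hx, hy⟩)
  have between : ∀ {x y z : X}, y ∈ M.geodesicInterval x z → ∀ i,
      (φ x i ≤ φ y i ∧ φ y i ≤ φ z i) ∨ (φ z i ≤ φ y i ∧ φ y i ≤ φ x i) := fun {x y z} h => by
    rw [← gridDist_eq_add_iff, ← hdist, ← hdist, ← hdist]
    exact h
  have gateS : ∀ x ∈ S, s ∈ M.geodesicInterval x t := fun x hx =>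
    hM.mem_geodesicInterval_of_closest hS hs (fun x hx => hmin' x hx t ht) hx
  have gateT : ∀ y ∈ T, t ∈ M.geodesicInterval y s := fun y hy =>
    hM.mem_geodesicInterval_of_closest hT ht (fun y hy => by
      rw [M.dist_comm, M.dist_comm (u := y)]; exact hmin' s hs y hy) hy
  obtain ⟨i, hi⟩ : ∃ i, φ s i ≠ φ t i := by
    by_contra! hall
    have h : M.dist s t = 0 := by
      rw [hdist, funext hall]
      simp [gridDist]
    rw [hM.1.dist_eq_zero_iff] at h
    exact hdisj ⟨s, hs, h ▸ ht⟩
  -- In coordinate i the gates give x ≤ s < t ≤ y, or the reverse.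
  refine ⟨i, (lt_or_gt_of_ne hi).imp (fun h x hx y hy => ?_) fun h x hx y hy => ?_⟩ <;>
  · rcases between (gateS x hx) i with h₁ | h₁ <;>
      rcases between (gateT y hy) i with h₂ | h₂ <;> order

end Median

/-! ### Translations between the representations -/

section Representations

variable {V : Type*} {G : SimpleGraph V}

theorem hasBoxRepresentation_of_nat_endpoints {k : ℕ} (a b : V → Fin k → ℕ)
    (hab : ∀ v i, a v i ≤ b v i)
    (hG : ∀ u v, u ≠ v → (G.Adj u v ↔ ∀ i, a u i ≤ b v i ∧ a v i ≤ b u i)) :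
    G.HasBoxRepresentation k := by
  have hle : ∀ v, (fun i => (a v i : ℝ)) ≤ fun i => (b v i : ℝ) := fun v i =>
    Nat.cast_le.mpr (hab v i)
  refine ⟨fun v i => a v i, fun v i => b v i, hle, fun v => Set.nonempty_Icc.mpr (hle v),
    fun u v huv => ?_⟩
  rw [hG u v huv, Icc_inter_Icc_nonempty_iff (hle u) (hle v), forall_and]
  simp [Pi.le_def]

theorem HasBoxRepresentation.exists_fin_endpoints [Finite V] {k : ℕ}
    (h : G.HasBoxRepresentation k) :
    ∃ (n : Fin k → ℕ) (a b : V → ∀ i, Fin (n i + 1)), (∀ v, a v ≤ b v) ∧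
      ∀ u v, u ≠ v → (G.Adj u v ↔ a u ≤ b v ∧ a v ≤ b u) := by
  obtain ⟨a, b, hab, -, hG⟩ := h
  choose n a' b' h' using fun i =>
    SimpleGraph.exists_fin_endpoints (fun v => a v i) (fun v => b v i)
  have hle : ∀ u v, ((fun i => a' i u) ≤ fun i => b' i v) ↔ a u ≤ b v := fun u v =>
    forall_congr' fun i => h' i u v
  refine ⟨n, fun v i => a' i v, fun v i => b' i v, fun v => (hle v v).mpr (hab v),
    fun u v huv => ?_⟩
  rw [hle, hle, hG u v huv, Icc_inter_Icc_nonempty_iff (hab u) (hab v)]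

theorem HasBoxRepresentation.exists_pathProduct [Finite V] {k : ℕ}
    (h : G.HasBoxRepresentation k) :
    ∃ n : Fin k → ℕ, G.IsConvexIntersectionGraph (pathProduct n) := by
  obtain ⟨n, a, b, hab, hG⟩ := h.exists_fin_endpoints
  refine ⟨n, fun v => (⊤ : (pathProduct n).Subgraph).induce (Set.Icc (a v) (b v)),
    fun v => isGeodesicallyConvex_Icc_pathProduct _ _, fun v => Set.nonempty_Icc.mpr (hab v),
    fun u v huv => ?_⟩
  rw [hG u v huv]
  exact (Icc_inter_Icc_nonempty_iff (hab u) (hab v)).symm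

theorem IsConvexIntersectionGraph.exists_hasPathMedianRepresentation {k : ℕ} {n : Fin k → ℕ}
    (h : G.IsConvexIntersectionGraph (pathProduct n)) :
    ∃ m ≤ k, G.HasPathMedianRepresentation m := by
  obtain ⟨m, hm, hdim⟩ := exists_pathDimension_pathProduct_eq n
  exact ⟨m, hm, _, inferInstance, pathProduct n, isMedianGraph_pathProduct n, hdim, h⟩

theorem HasPathMedianRepresentation.hasBoxRepresentation {k : ℕ}
    (h : G.HasPathMedianRepresentation k) : G.HasBoxRepresentation k := by
  obtain ⟨X, _, M, hM, hdim, S, hconv, hne, hG⟩ := h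
  -- A finite path-dimension is attained by an actual embedding.
  obtain ⟨n, φ, hφ⟩ := ((iInf_natCast_eq_iff_isLeast _ k).mp hdim).1
  choose p hp hpmin using fun v i =>
    (S v).verts.toFinite.exists_minimalFor (fun x => φ x i) _ (hne v)
  choose q hq hqmax using fun v i =>
    (S v).verts.toFinite.exists_maximalFor (fun x => φ x i) _ (hne v)
  have hmin : ∀ v i, ∀ x ∈ (S v).verts, φ (p v i) i ≤ φ x i := fun v i x hx =>
    (le_total _ _).elim id (hpmin v i hx)
  have hmax : ∀ v i, ∀ x ∈ (S v).verts, φ x i ≤ φ (q v i) i := fun v i x hx =>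
    (le_total _ _).elim id (hqmax v i hx)
  refine hasBoxRepresentation_of_nat_endpoints (fun v i => φ (p v i) i)
    (fun v i => φ (q v i) i) (fun v i => hmin v i _ (hq v i)) fun u v huv => ?_
  rw [hG u v huv]
  constructor
  · rintro ⟨x, hxu, hxv⟩ i
    exact ⟨(hmin u i x hxu).trans (hmax v i x hxv), (hmin v i x hxv).trans (hmax u i x hxu)⟩
  · intro hall
    by_contra hdisj
    obtain ⟨i, hi | hi⟩ := hM.exists_coordinate_separating hφ (hconv u) (hconv v) (hne u)
      (hne v) hdisj
    · exact (hi _ (hq u i) _ (hp v i)).not_ge (hall i).2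
    · exact (hi _ (hp u i) _ (hq v i)).not_ge (hall i).1

/-- Clique bags mean that the completion adds no edge to G. -/
theorem hasPathMedianRepresentation_iff_exists_isComplete {k : ℕ} :
    G.HasPathMedianRepresentation k ↔ ∃ D : G.PathMedianDecomposition k, D.IsComplete := by
  constructor
  · rintro ⟨X, hX, M, hM, hdim, S, hconv, hS⟩
    refine ⟨⟨X, hX, M, hM, hdim, fun x => {v | x ∈ (S v).verts}, G, le_rfl, hconv, hS⟩, ?_⟩
    intro x u hu v hv huv
    exact (hS.2 u v huv).mpr ⟨x, hu, hv⟩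
  · rintro ⟨D, hD⟩
    refine ⟨D.X, D.finite, D.M, D.isMedianGraph, D.pathDimension_eq,
      fun v => (⊤ : D.M.Subgraph).induce {x | v ∈ D.bag x}, D.convex,
      D.isIntersectionGraph.1, fun u v huv => ⟨fun h => ?_, ?_⟩⟩
    · exact (D.isIntersectionGraph.2 u v huv).mp (D.le_completion h)
    · rintro ⟨x, hu, hv⟩
      exact hD x hu hv huv

/-- The path-decomposition in which `v` occupies the subpath from `a v` to `b v`. -/
def PathDecomposition.ofEndpoints {n : ℕ} (a b : V → Fin (n + 1)) (hab : ∀ v, a v ≤ b v)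
    (hG : ∀ u v, G.Adj u v → a u ≤ b v ∧ a v ≤ b u) : G.PathDecomposition where
  n := n
  bag t := {v | t ∈ Set.Icc (a v) (b v)}
  completion :=
    { Adj := fun u v => u ≠ v ∧ a u ≤ b v ∧ a v ≤ b u
      symm := ⟨fun _ _ h => ⟨h.1.symm, h.2.2, h.2.1⟩⟩
      loopless := ⟨fun _ h => h.1 rfl⟩ }
  le_completion := fun u v h => ⟨h.ne, hG u v h⟩
  isIntervalGraph := by
    have hle : ∀ v, ((a v : ℕ) : ℝ) ≤ (b v : ℕ) := fun v => Nat.cast_le.mpr (hab v)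
    refine ⟨fun v => Set.Icc ((a v : ℕ) : ℝ) (b v : ℕ), fun v => Set.ordConnected_Icc,
      fun v => Set.nonempty_Icc.mpr (hle v), fun u v huv => ?_⟩
    rw [Icc_inter_Icc_nonempty_iff (hle u) (hle v), Nat.cast_le, Nat.cast_le]
    exact and_iff_right huv
  connected := fun v => connected_induce_pathGraph_Icc (hab v)
  isIntersectionGraph := ⟨fun v => Set.nonempty_Icc.mpr (hab v), fun u v huv =>
    (and_iff_right huv).trans (Icc_inter_Icc_nonempty_iff (hab u) (hab v)).symm⟩

theorem HasBoxRepresentation.exists_isNonEdgeSeparating [Finite V] {k : ℕ}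
    (h : G.HasBoxRepresentation k) :
    ∃ m ≤ k, ∃ F : Finset G.PathDecomposition, F.card = m ∧ IsNonEdgeSeparating F := by
  classical
  obtain ⟨n, a, b, hab, hG⟩ := h.exists_fin_endpoints
  let D : Fin k → G.PathDecomposition := fun i =>
    PathDecomposition.ofEndpoints (fun v => a v i) (fun v => b v i) (fun v => hab v i)
      fun u v huv => ⟨((hG u v huv.ne).mp huv).1 i, ((hG u v huv.ne).mp huv).2 i⟩
  -- Different coordinates may give the same decomposition, so only at most k members are
  -- guaranteed.
  refine ⟨(Finset.univ.image D).card, Finset.card_image_le.trans_eq (Finset.card_fin k),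
    _, rfl, fun u v huv hadj => ?_⟩
  by_contra! hall
  refine hadj ((hG u v huv).mpr ?_)
  have hD : ∀ i, (D i).completion.Adj u v := fun i =>
    not_not.mp (hall (D i) (Finset.mem_image_of_mem D (Finset.mem_univ i)))
  exact ⟨fun i => (hD i).2.1, fun i => (hD i).2.2⟩

theorem PathDecomposition.exists_endpoints (D : G.PathDecomposition) :
    ∃ a b : V → ℕ, (∀ v, a v ≤ b v) ∧
      ∀ u v, u ≠ v → (D.completion.Adj u v ↔ a u ≤ b v ∧ a v ≤ b u) := by
  choose a b hab hbag using fun v => exists_eq_Icc_of_ordConnected (D.isIntersectionGraph.1 v)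
    (ordConnected_of_connected_induce_pathGraph (D.connected v))
  refine ⟨fun v => a v, fun v => b v, hab, fun u v huv => ?_⟩
  rw [D.isIntersectionGraph.2 u v huv, hbag u, hbag v,
    Icc_inter_Icc_nonempty_iff (hab u) (hab v)]
  rfl

theorem IsNonEdgeSeparating.hasBoxRepresentation {F : Finset G.PathDecomposition}
    (hF : IsNonEdgeSeparating F) : G.HasBoxRepresentation F.card := by
  choose a b hab hadj using fun D : G.PathDecomposition => D.exists_endpoints
  let e := F.equivFin.symm
  refine hasBoxRepresentation_of_nat_endpoints (fun v i => a (e i) v) (fun v i => b (e i) v)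
    (fun v i => hab _ v) fun u v huv => ?_
  constructor
  · exact fun h i => (hadj _ u v huv).mp ((e i : G.PathDecomposition).le_completion h)
  · intro hall
    by_contra hG
    obtain ⟨D, hD, hsep⟩ := hF u v huv hG
    refine hsep ((hadj D u v huv).mpr ?_)
    simpa [e] using hall (F.equivFin ⟨D, hD⟩)

end Representations

end SimpleGraph

theorem mainTheorem5 {V : Type*} [Finite V] (G : SimpleGraph V) (k : ℕ) (hk : 0 < k) :
    List.TFAE [
      G.boxicity = k,
      IsLeast {m : ℕ | ∃ F : Finset G.PathDecomposition,
        F.card = m ∧ SimpleGraph.IsNonEdgeSeparating F} k,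
      IsLeast {m : ℕ | ∃ n : Fin m → ℕ,
        G.IsConvexIntersectionGraph (SimpleGraph.pathProduct n)} k,
      IsLeast {m : ℕ | G.HasPathMedianRepresentation m} k,
      G.pathMedianDimension = k] := by
  have box_path := SimpleGraph.isLeast_congr_of_forall_exists_le
    (S := {m | G.HasBoxRepresentation m})
    (T := {m | ∃ F : Finset G.PathDecomposition, F.card = m ∧ SimpleGraph.IsNonEdgeSeparating F})
    (fun _ h => h.exists_isNonEdgeSeparating)
    (fun m ⟨_, hm, hF⟩ => ⟨m, le_rfl, hm ▸ hF.hasBoxRepresentation⟩) k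
  have box_product := SimpleGraph.isLeast_congr_of_forall_exists_le
    (S := {m | G.HasBoxRepresentation m})
    (T := {m | ∃ n : Fin m → ℕ, G.IsConvexIntersectionGraph (SimpleGraph.pathProduct n)})
    (fun m h => ⟨m, le_rfl, h.exists_pathProduct⟩)
    (fun _ ⟨_, h⟩ =>
      let ⟨l, hl, h'⟩ := h.exists_hasPathMedianRepresentation
      ⟨l, hl, h'.hasBoxRepresentation⟩) k
  have box_median := SimpleGraph.isLeast_congr_of_forall_exists_le
    (S := {m | G.HasBoxRepresentation m}) (T := {m | G.HasPathMedianRepresentation m})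
    (fun _ h => h.exists_pathProduct.choose_spec.exists_hasPathMedianRepresentation)
    (fun m h => ⟨m, le_rfl, h.hasBoxRepresentation⟩) k
  have box : G.boxicity = k ↔ IsLeast {m | G.HasBoxRepresentation m} k :=
    SimpleGraph.iInf_natCast_eq_iff_isLeast _ k
  have median : G.pathMedianDimension = k ↔ IsLeast {m | G.HasPathMedianRepresentation m} k := by
    simp only [SimpleGraph.hasPathMedianRepresentation_iff_exists_isComplete]
    exact SimpleGraph.iInf_natCast_eq_iff_isLeast _ k
  rw [box, median, ← box_path, ← box_product, ← box_median]
  simp only [List.TFAE, List.mem_cons, List.not_mem_nil, or_false]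
  rintro _ (rfl | rfl | rfl | rfl | rfl) _ (rfl | rfl | rfl | rfl | rfl) <;> exact Iff.rfl
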